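/- Let $\mathfrak h$ be a finite dimensional complex vector space and let $W\subset GL(\mathfrak h)$ be a real reflection group, i.e. a finite group generated by complex reflections (elements $s$ with $\operatorname{rank}(s-1)=1$) all of whose elements have real matrices in some fixed basis of $\mathfrak h$. Let $S$ be the set of reflections of $W$ and let $c:S\to\mathbb C$ be a conjugation invariant function. For $s\in S$ let $\alpha_s\in\mathfrak h^*$ vanish on the reflection hyperplane of $s$ in $\mathfrak h$, let $\alpha_s^\vee\in\mathfrak h$ vanish on the reflection hyperplane of $s$ in $\mathfrak h^*$, normalized by $(\alpha_s^\vee,\alpha_s)=2$. Let $H_c(W)$ be the rational Cherednik algebra, generated over $\mathbb C$ by the group $W$ and the vector spaces $\mathfrak h^*$ and $\mathfrak h$, with defining relations $$gxg^{-1}=x^g,\quad gyg^{-1}=y^g,\quad [x,x']=0,\quad [y,y']=0,\quad [y,x]=(y,x)-\sum_{s\in S}c_s\,(y,\alpha_s)(\alpha_s^\vee,x)\,s$$ for $x,x'\in\mathfrak h^*$, $y,y'\in\mathfrak h$, $g\in W$. Let $M_c=H_c(W)\otimes_{\mathbb C[W]\ltimes\mathbb C[\mathfrak h^*]}\mathbb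 C$ be its polynomial representation, induced from the trivial representation of $W$ on which all $y\in\mathfrak h$ act by $0$; it is identified with $\mathbb C[\mathfrak h]$ by $f\mapsto f\cdot 1$. Let $L_c$ be the irreducible quotient of $M_c$ (its quotient by the sum of all proper submodules). Let $J\subsetneq M_c$ be a proper $H_c(W)$-submodule. Then $J$ is an ideal of $\mathbb C[\mathfrak h]$, so that $A=M_c/J$ is a commutative algebra. If $A$ is finite dimensional over $\mathbb C$ and Gorenstein, i.e. $A\cong\operatorname{Hom}_{\mathbb C}(A,\mathbb C)$ as $A$-modules, then $A=L_c$: $J$ is the sum of all proper submodules of $M_c$, and $A$ is an irreducible $H_c(W)$-module. -/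

import Mathlib

namespace RationalCherednik

open Module

noncomputable section

variable {V : Type*} [AddCommGroup V] [Module ℂ V]

/-- The set of complex reflections of `W`: the elements `s` for which `s - 1` has rank one. -/
def reflections (W : Subgroup (V ≃ₗ[ℂ] V)) : Set W :=
  {s | finrank ℂ (LinearMap.range (((s : V ≃ₗ[ℂ] V) : V →ₗ[ℂ] V) - LinearMap.id)) = 1}

/-- `W` is a real reflection group acting on the (complexified) reflection representation `V`:
it is finite, generated by its reflections, and preserves a real form of `V`, i.e. all its
elements have real matrices in some fixed basis of `V`. -/
structure IsRealReflectionGroup (W : Subgroup (V ≃ₗ[ℂ] V)) : Prop where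
  finite : Finite W
  generated : Subgroup.closure (reflections W) = ⊤
  real : ∃ (n : ℕ) (b : Basis (Fin n) ℂ V), ∀ g ∈ W, ∀ i j, (b.repr (g (b j)) i).im = 0

/-- The natural action of `g ∈ W` on `V^*`: `(x^g)(y) = x(g⁻¹ y)`. -/
def dualAct {W : Subgroup (V ≃ₗ[ℂ] V)} (g : W) (x : Dual ℂ V) : Dual ℂ V :=
  x ∘ₗ (((g⁻¹ : W) : V ≃ₗ[ℂ] V) : V →ₗ[ℂ] V)

/-- A choice, for every reflection `s`, of `α_s ∈ V^*` vanishing on the reflection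
hyperplane of `s` in `V` and of `α_s^∨ ∈ V` which, as a linear function on `V^*`, vanishes on
the reflection hyperplane of `s` in `V^*`, normalized by `(α_s^∨, α_s) = 2`
(in particular both are nonzero). -/
structure RootChoice (W : Subgroup (V ≃ₗ[ℂ] V)) where
  root : reflections W → Dual ℂ V
  coroot : reflections W → V
  root_vanish : ∀ (s : reflections W) (y : V), (s.1 : V ≃ₗ[ℂ] V) y = y → root s y = 0
  coroot_vanish : ∀ (s : reflections W) (x : Dual ℂ V), dualAct s.1 x = x → x (coroot s) = 0
  pairing : ∀ s : reflections W, root s (coroot s) = 2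

/-- A conjugation invariant function on the set of reflections. -/
def ConjInvariant {W : Subgroup (V ≃ₗ[ℂ] V)} (c : reflections W → ℂ) : Prop :=
  ∀ s t : reflections W, IsConj s.1 t.1 → c s = c t

/-- Generators of the rational Cherednik algebra: `g ∈ W`, `x ∈ V^*`, `y ∈ V`. -/
inductive Gen (W : Subgroup (V ≃ₗ[ℂ] V)) : Type _
  | grp (g : W)
  | pos (x : Dual ℂ V)
  | mom (y : V)

section Free

variable {W : Subgroup (V ≃ₗ[ℂ] V)}

/-- The generator `g ∈ W` of the free algebra. -/
def fg (g : W) : FreeAlgebra ℂ (Gen W) := FreeAlgebra.ι ℂ (Gen.grp g)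

/-- The generator `x ∈ V^*` of the free algebra. -/
def fx (x : Dual ℂ V) : FreeAlgebra ℂ (Gen W) := FreeAlgebra.ι ℂ (Gen.pos x)

/-- The generator `y ∈ V` of the free algebra. -/
def fy (y : V) : FreeAlgebra ℂ (Gen W) := FreeAlgebra.ι ℂ (Gen.mom y)

/-- The defining relations of `H_c(W)`. The first six say that `W`, `V^*` and `V` generate
images of the group algebra of `W` and of the vector spaces `V^*` and `V`. -/
inductive Rel (R : RootChoice W) (c : reflections W → ℂ) :
    FreeAlgebra ℂ (Gen W) → FreeAlgebra ℂ (Gen W) → Prop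
  | grp_one : Rel R c (fg 1) 1
  | grp_mul (g g' : W) : Rel R c (fg (g * g')) (fg g * fg g')
  | pos_add (x x' : Dual ℂ V) : Rel R c (fx (x + x')) (fx x + fx x')
  | pos_smul (a : ℂ) (x : Dual ℂ V) : Rel R c (fx (a • x)) (a • fx x)
  | mom_add (y y' : V) : Rel R c (fy (y + y')) (fy y + fy y')
  | mom_smul (a : ℂ) (y : V) : Rel R c (fy (a • y)) (a • fy y)
  | grp_pos (g : W) (x : Dual ℂ V) : Rel R c (fg g * fx x * fg g⁻¹) (fx (dualAct g x))
  | grp_mom (g : W) (y : V) : Rel R c (fg g * fy y * fg g⁻¹) (fy ((g : V ≃ₗ[ℂ] V) y))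
  | pos_comm (x x' : Dual ℂ V) : Rel R c (fx x * fx x') (fx x' * fx x)
  | mom_comm (y y' : V) : Rel R c (fy y * fy y') (fy y' * fy y)
  | mom_pos (y : V) (x : Dual ℂ V) :
      Rel R c (fy y * fx x - fx x * fy y)
        (algebraMap ℂ _ (x y)
          - ∑ᶠ s : reflections W, (c s * R.root s y * x (R.coroot s)) • fg s.1)

end Free

variable {W : Subgroup (V ≃ₗ[ℂ] V)} (R : RootChoice W) (c : reflections W → ℂ)

/-- The rational Cherednik algebra `H_c(W)`. -/
abbrev CherednikAlgebra := RingQuot (Rel R c)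

/-- The image of `g ∈ W` in `H_c(W)`. -/
def hg (g : W) : CherednikAlgebra R c := RingQuot.mkAlgHom ℂ (Rel R c) (fg g)

/-- The map `V → H_c(W)`. -/
def hy (y : V) : CherednikAlgebra R c := RingQuot.mkAlgHom ℂ (Rel R c) (fy y)

/-- The linear map `V^* → H_c(W)`. -/
def hx : Dual ℂ V →ₗ[ℂ] CherednikAlgebra R c where
  toFun x := RingQuot.mkAlgHom ℂ (Rel R c) (fx x)
  map_add' x x' := by
    rw [RingQuot.mkAlgHom_rel ℂ (Rel.pos_add x x'), map_add]
  map_smul' a x := by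
    rw [RingQuot.mkAlgHom_rel ℂ (Rel.pos_smul a x), map_smul, RingHom.id_apply]

theorem hx_comm (x x' : Dual ℂ V) : hx R c x * hx R c x' = hx R c x' * hx R c x := by
  simp only [hx, LinearMap.coe_mk, AddHom.coe_mk, ← map_mul]
  exact RingQuot.mkAlgHom_rel ℂ (Rel.pos_comm x x')

/-- `ℂ[V] = S(V^*)`, the algebra of polynomial functions on `V`. -/
abbrev Poly (V : Type*) [AddCommGroup V] [Module ℂ V] := SymmetricAlgebra ℂ (Dual ℂ V)

/-- The algebra map `ℂ[V] → H_c(W)`, `f ↦ f(x)`. -/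
def polyMap : Poly V →ₐ[ℂ] CherednikAlgebra R c :=
  RingCon.liftₐ _ (TensorAlgebra.lift ℂ (hx R c)) <| by
    refine RingCon.ringConGen_le.2 (fun t t' h => ?_)
    induction h with | mul_comm x x'
    rw [RingCon.ker_apply]
    simp [hx_comm R c x x']

theorem polyMap_ι (x : Dual ℂ V) :
    polyMap R c (SymmetricAlgebra.ι ℂ (Dual ℂ V) x) = hx R c x := by
  change TensorAlgebra.lift ℂ (hx R c) (TensorAlgebra.ι ℂ x) = hx R c x
  exact TensorAlgebra.lift_ι_apply _ x

/-- The left ideal of `H_c(W)` generated by `y ∈ V` and `g - 1`, `g ∈ W`. -/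
def lowestWeightIdeal : Submodule (CherednikAlgebra R c) (CherednikAlgebra R c) :=
  Submodule.span _ (Set.range (hy R c) ∪ Set.range (fun g : W => hg R c g - 1))

/-- The polynomial representation `M_c`, i.e. the `H_c(W)`-module induced from the trivial
representation of `ℂ[W] ⋉ ℂ[V^*]` on which `y ∈ V` acts by `0`. It is the quotient of `H_c(W)`
by the left ideal generated by the annihilator in `ℂ[W] ⋉ ℂ[V^*]` of the trivial
representation, and `f ↦ f · 1` identifies it with `ℂ[V]` as a vector space. -/
abbrev PolyRep := CherednikAlgebra R c ⧸ lowestWeightIdeal R c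

/-- The lowest weight vector `1 ∈ M_c`. -/
def vac : PolyRep R c := Submodule.Quotient.mk 1

variable {R c}

/-- A submodule `J ⊆ M_c` regarded as an ideal of `ℂ[V]`: all `f` with `f · 1 ∈ J`. The quotient
`ℂ[V] ⧸ toIdeal J` is `M_c ⧸ J` with its structure of a commutative algebra. -/
def toIdeal (J : Submodule (CherednikAlgebra R c) (PolyRep R c)) : Ideal (Poly V) where
  carrier := {f | polyMap R c f • vac R c ∈ J}
  add_mem' := by
    intro f f' hf hf'
    simp only [Set.mem_ofPred_eq, map_add, add_smul] at *
    exact J.add_mem hf hf'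
  zero_mem' := by simp
  smul_mem' := by
    intro a f hf
    simp only [Set.mem_ofPred_eq, smul_eq_mul, map_mul, mul_smul] at *
    exact J.smul_mem _ hf

variable (R c)

/-- The largest proper submodule of `M_c`, the sum of all proper submodules. The irreducible
quotient of `M_c` is `L_c = M_c ⧸ maxSubmodule`. -/
def maxSubmodule : Submodule (CherednikAlgebra R c) (PolyRep R c) :=
  sSup {N | N ≠ ⊤}

end

/-- A finite dimensional commutative algebra `A` over a field `k` is Gorenstein if it is
isomorphic, as an `A`-module, to its canonical module `ω_A = Hom_k(A, k)`, on which `A` acts by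
`(a · φ)(b) = φ (a b)`. -/
def IsGorensteinFinDim (k A : Type*) [Field k] [CommRing A] [Algebra k A] : Prop :=
  FiniteDimensional k A ∧
    ∃ e : A ≃ₗ[k] Module.Dual k A, ∀ a a' b : A, e (a * a') b = e a' (a * b)

end RationalCherednik

/-! A real reflection group preserves a nondegenerate symmetric bilinear form. In orthonormal
coordinates x_i, y_i the operators h = ½∑(x_i y_i + y_i x_i), E = ½∑x_i², F = -½∑y_i² satisfy the
sl₂ relations (`CherednikRep.isSl2Triple`), and h acts on the image of degree d polynomials by κ + d
for a constant κ (`CherednikRep.euler_apply_layer`).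

Let A = M_c/J, with generator v in degree 0 and top degree D. The Gorenstein isomorphism yields a
functional that is injective on the socle of A, the vectors killed by all x, so the socle is spanned
by any nonzero u of degree D. A nonzero submodule N contains a socle vector, hence u. Now u has
highest weight κ + D, v has lowest weight κ, and every weight of A lies in κ + {0, …, D}. Invariance
of weights under negation forces κ + D = -κ, so a power of F carries u to a nonzero vector of degree
0, a multiple of v. Thus v ∈ N and N = A (`CherednikRep.Invariant.lowestWeight_mem`).

So A is simple and J is maximal. Proper submodules of M_c have no degree 0 component, so the sum of
two of them is proper (`sup_ne_top`) and there is only one maximal submodule. -/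

namespace RationalCherednik

/-! ### The invariant bilinear form, roots and coroots -/

open Module

noncomputable section

variable {V : Type*} [AddCommGroup V] [Module ℂ V]

/-- A bilinear form together with an orthonormal basis, invariant under `W`. -/
structure InvariantForm (W : Subgroup (V ≃ₗ[ℂ] V)) (n : ℕ) where
  form : LinearMap.BilinForm ℂ V
  basis : Basis (Fin n) ℂ V
  symm : ∀ v w, form v w = form w v
  invariant : ∀ g : W, ∀ v w, form ((g : V ≃ₗ[ℂ] V) v) ((g : V ≃ₗ[ℂ] V) w) = form v w
  orthonormal : ∀ i j, form (basis i) (basis j) = if i = j then 1 else 0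

/-- The sum over the group of the transforms of the standard form of a basis. -/
def averagedForm {W : Subgroup (V ≃ₗ[ℂ] V)} [Fintype W] {n : ℕ} (b : Basis (Fin n) ℂ V) :
    LinearMap.BilinForm ℂ V :=
  ∑ g : W, ∑ j, (LinearMap.mul ℂ ℂ).compl₁₂
    (b.coord j ∘ₗ ((g : V ≃ₗ[ℂ] V) : V →ₗ[ℂ] V)) (b.coord j ∘ₗ ((g : V ≃ₗ[ℂ] V) : V →ₗ[ℂ] V))

theorem averagedForm_apply {W : Subgroup (V ≃ₗ[ℂ] V)} [Fintype W] {n : ℕ}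
    (b : Basis (Fin n) ℂ V) (v w : V) :
    averagedForm (W := W) b v w =
      ∑ g : W, ∑ j, b.repr ((g : V ≃ₗ[ℂ] V) v) j * b.repr ((g : V ≃ₗ[ℂ] V) w) j := by
  simp [averagedForm, LinearMap.sum_apply]

theorem averagedForm_invariant {W : Subgroup (V ≃ₗ[ℂ] V)} [Fintype W] {n : ℕ}
    (b : Basis (Fin n) ℂ V) (h : W) (v w : V) :
    averagedForm (W := W) b ((h : V ≃ₗ[ℂ] V) v) ((h : V ≃ₗ[ℂ] V) w) =
      averagedForm (W := W) b v w := by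
  rw [averagedForm_apply, averagedForm_apply]
  exact Fintype.sum_equiv (Equiv.mulRight h) _ _ fun g => rfl

/-- Pair v with its coordinatewise conjugate w. As each g is real in the basis, the coordinates of g
w are conjugate to those of g v, so the pairing is a sum of squared absolute values; the term g = 1
alone already gives v = 0. -/
theorem averagedForm_nondegenerate {W : Subgroup (V ≃ₗ[ℂ] V)} [Fintype W] {n : ℕ}
    (b : Basis (Fin n) ℂ V) (hb : ∀ g ∈ W, ∀ i j, (b.repr (g (b j)) i).im = 0)
    (v : V) (hv : ∀ w, averagedForm (W := W) b v w = 0) : v = 0 := by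
  set w : V := ∑ j, (starRingEnd ℂ (b.repr v j)) • b j with hw
  have key : ∀ g : W, ∀ i, b.repr ((g : V ≃ₗ[ℂ] V) w) i =
      starRingEnd ℂ (b.repr ((g : V ≃ₗ[ℂ] V) v) i) := by
    intro g i
    conv_rhs => rw [← b.sum_repr v]
    simp only [hw, map_sum, map_smul, Finsupp.coe_finsetSum, Finset.sum_apply, Finsupp.smul_apply,
      smul_eq_mul, map_mul]
    refine Finset.sum_congr rfl fun j _ => ?_
    rw [Complex.conj_eq_iff_im.2 (hb g g.2 i j)]
  have h0 := hv w
  rw [averagedForm_apply] at h0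
  simp only [key, Complex.mul_conj] at h0
  norm_cast at h0
  rw [Finset.sum_eq_zero_iff_of_nonneg fun g _ =>
    Finset.sum_nonneg fun j _ => Complex.normSq_nonneg _] at h0
  have h1 := h0 1 (Finset.mem_univ _)
  rw [Finset.sum_eq_zero_iff_of_nonneg fun j _ => Complex.normSq_nonneg _] at h1
  refine b.repr.map_eq_zero_iff.1 (Finsupp.ext fun j => ?_)
  simpa using h1 j (Finset.mem_univ _)

theorem exists_orthonormal_basis [FiniteDimensional ℂ V] (B : LinearMap.BilinForm ℂ V)
    (hsymm : ∀ v w, B v w = B w v) (hB : ∀ v, (∀ w, B v w = 0) → v = 0) :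
    ∃ b : Basis (Fin (finrank ℂ V)) ℂ V, ∀ i j, B (b i) (b j) = if i = j then 1 else 0 := by
  obtain ⟨b, hb⟩ := LinearMap.BilinForm.exists_orthogonal_basis (B := B) ⟨fun v w => hsymm v w⟩
  have hne : ∀ i, B (b i) (b i) ≠ 0 := by
    intro i hi
    refine b.ne_zero i (hB _ fun w => ?_)
    rw [← b.sum_repr w, map_sum]
    refine Finset.sum_eq_zero fun j _ => ?_
    rw [map_smul]
    by_cases hij : i = j
    · rw [← hij, hi, smul_zero]
    · rw [hb hij, smul_zero]
  -- The form is bilinear over ℂ, so an orthogonal basis is normalized by complex square roots.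
  have hsq : ∀ i, ∃ z : ℂ, B (b i) (b i) = z ^ 2 := fun i => by
    obtain ⟨z, hz⟩ := IsAlgClosed.exists_pow_nat_eq (B (b i) (b i)) (n := 2) (by norm_num)
    exact ⟨z, hz.symm⟩
  choose z hz using hsq
  have hz0 : ∀ i, z i ≠ 0 := fun i h => hne i (by rw [hz, h]; simp)
  refine ⟨b.isUnitSMul (w := fun i => (z i)⁻¹) fun i => (inv_ne_zero (hz0 i)).isUnit,
    fun i j => ?_⟩
  simp only [Basis.isUnitSMul_apply, map_smul, LinearMap.smul_apply, smul_eq_mul]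
  split_ifs with hij
  · subst hij
    rw [hz]
    field_simp [hz0 i]
  · rw [hb hij]; simp

theorem IsRealReflectionGroup.exists_invariantForm [FiniteDimensional ℂ V]
    {W : Subgroup (V ≃ₗ[ℂ] V)} (hW : IsRealReflectionGroup W) :
    Nonempty (InvariantForm W (finrank ℂ V)) := by
  have := hW.finite
  have := Fintype.ofFinite W
  obtain ⟨n, b, hb⟩ := hW.real
  have hs : ∀ v w, averagedForm (W := W) b v w = averagedForm (W := W) b w v := fun v w => by
    simp only [averagedForm_apply, mul_comm]
  obtain ⟨e, he⟩ := exists_orthonormal_basis _ hs (averagedForm_nondegenerate b hb)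
  exact ⟨⟨_, e, hs, averagedForm_invariant b, he⟩⟩

namespace InvariantForm

variable {W : Subgroup (V ≃ₗ[ℂ] V)} {n : ℕ} (F : InvariantForm W n)

theorem repr_eq (v : V) (i : Fin n) : F.basis.repr v i = F.form v (F.basis i) := by
  have h := congrArg (fun w => F.form w (F.basis i)) (F.basis.sum_repr v)
  simpa only [map_sum, map_smul, LinearMap.sum_apply, LinearMap.smul_apply, F.orthonormal,
    smul_eq_mul, mul_ite, mul_one, mul_zero, Finset.sum_ite_eq', Finset.mem_univ, if_true] using h

theorem sum_form_smul (v : V) : ∑ i, F.form v (F.basis i) • F.basis i = v := by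
  simp only [← F.repr_eq, F.basis.sum_repr]

theorem sum_apply_smul (x : Dual ℂ V) : ∑ i, x (F.basis i) • F.form (F.basis i) = x := by
  ext v
  conv_rhs => rw [← F.sum_form_smul v]
  simp [LinearMap.sum_apply, F.symm v, mul_comm]

theorem nondegenerate (v : V) (hv : ∀ w, F.form v w = 0) : v = 0 := by
  rw [← F.sum_form_smul v]
  simp [hv]

/-- A reflection is orthogonal, so its root and coroot are related by the form. -/
theorem reflection_properties (R : RootChoice W) (s : reflections W) :
    (s.1 : V ≃ₗ[ℂ] V) (R.coroot s) = - R.coroot s ∧ dualAct s.1 (R.root s) = - R.root s ∧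
      ∃ k : ℂ, ∀ v, F.form (R.coroot s) v = k * R.root s v := by
  set T : V →ₗ[ℂ] V := ((s.1 : V ≃ₗ[ℂ] V) : V →ₗ[ℂ] V) - LinearMap.id with hT
  set α := R.root s with hα
  set β := R.coroot s with hβ
  have hTy : ∀ y, T y = (s.1 : V ≃ₗ[ℂ] V) y - y := fun y => rfl
  have hαβ : α β = 2 := R.pairing s
  have hker : α ∈ (LinearMap.ker T).dualAnnihilator := by
    rw [Submodule.mem_dualAnnihilator]
    intro w hw
    refine R.root_vanish s w ?_
    rw [LinearMap.mem_ker, hTy, sub_eq_zero] at hw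
    exact hw
  rw [← LinearMap.range_dualMap_eq_dualAnnihilator_ker] at hker
  -- α vanishes on the kernel of T = s - 1, so it factors as δ ∘ T. As T has rank one, this gives T
  -- y = (α y / 2) T β.
  obtain ⟨δ, hδ⟩ := hker
  have hδ' : ∀ y, δ (T y) = α y := fun y => by rw [← hδ]; rfl
  have hu0 : T β ≠ 0 := by
    intro h
    have := hδ' β
    rw [h, hαβ, map_zero] at this
    norm_num at this
  have hrank : finrank ℂ (LinearMap.range T) = 1 := s.2
  have hTu : ∀ y, T y = (α y / 2) • T β := by
    intro y
    obtain ⟨t, ht⟩ := exists_smul_eq_of_finrank_eq_one hrank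
      (x := (⟨T β, LinearMap.mem_range_self _ _⟩ : LinearMap.range T))
      (by simpa [Subtype.ext_iff] using hu0) ⟨T y, LinearMap.mem_range_self _ _⟩
    have ht' : t • T β = T y := congrArg Subtype.val ht
    have : α y = t * 2 := by rw [← hδ' y, ← ht', map_smul, hδ' β, hαβ, smul_eq_mul]
    rw [← ht', this]
    congr 1
    ring
  set u := T β with hu
  have hs : ∀ y, (s.1 : V ≃ₗ[ℂ] V) y = y + (α y / 2) • u := fun y => by
    rw [← hTu, hTy]; abel
  -- Otherwise some functional kills u but not β; killing u makes it fixed by s, so `coroot_vanish`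
  -- says that it kills β.
  have hβu : β ∈ Submodule.span ℂ {u} := by
    by_contra hcon
    obtain ⟨x, hx, hxu⟩ := Submodule.exists_le_ker_of_notMem hcon
    have hxu0 : x u = 0 := hxu (Submodule.mem_span_singleton_self u)
    refine hx (R.coroot_vanish s x ?_)
    ext y
    have h1 := hs (((s.1⁻¹ : W) : V ≃ₗ[ℂ] V) y)
    have h2 : (s.1 : V ≃ₗ[ℂ] V) (((s.1⁻¹ : W) : V ≃ₗ[ℂ] V) y) = y := by simp
    rw [h2] at h1
    change x (((s.1⁻¹ : W) : V ≃ₗ[ℂ] V) y) = x y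
    conv_rhs => rw [h1]
    simp [hxu0]
  obtain ⟨r, hr⟩ := Submodule.mem_span_singleton.1 hβu
  have horth : ∀ y y', (α y / 2) * F.form u y' + (α y' / 2) * F.form y u
      + (α y / 2) * (α y' / 2) * F.form u u = 0 := by
    intro y y'
    have := F.invariant s.1 y y'
    rw [hs, hs] at this
    simp only [map_add, map_smul, LinearMap.add_apply, LinearMap.smul_apply, smul_eq_mul] at this
    linear_combination this
  -- Obtained by solving `horth` at y' = β for the pairing of y with u.
  set k := -(F.form u β + F.form u u) / 2 with hk
  have hform : ∀ y, F.form u y = k * α y := by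
    intro y
    have := horth y β
    rw [hαβ, F.symm y u] at this
    rw [hk]
    linear_combination this
  have hk0 : k ≠ 0 := fun h0 => hu0 (F.nondegenerate _ fun w => by rw [hform, h0, zero_mul])
  -- Orthogonality makes s an involution: this value says exactly that s u = -u.
  have hαu : α u = -4 := by
    have := horth β β
    rw [F.symm β u, hform, hform, hαβ] at this
    have h2 : k * (α u + 4) = 0 := by linear_combination this
    have := (mul_eq_zero.1 h2).resolve_left hk0
    linear_combination this
  have hru : r = -1 / 2 := by
    have := hαβ
    rw [← hr, map_smul, hαu, smul_eq_mul] at this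
    linear_combination (-1 / 4) * this
  have huβ : u = (-2 : ℂ) • β := by
    rw [← hr, hru, smul_smul]; norm_num
  refine ⟨?_, ?_, -k / 2, fun v => ?_⟩
  · rw [hs, hαβ, huβ]; module
  · ext y
    have h1 := hs (((s.1⁻¹ : W) : V ≃ₗ[ℂ] V) y)
    have h2 : (s.1 : V ≃ₗ[ℂ] V) (((s.1⁻¹ : W) : V ≃ₗ[ℂ] V) y) = y := by simp
    rw [h2] at h1
    change α (((s.1⁻¹ : W) : V ≃ₗ[ℂ] V) y) = - α y
    conv_rhs => rw [h1]
    simp only [map_add, map_smul, hαu, smul_eq_mul]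
    ring
  · have := hform v
    rw [huβ, map_smul, LinearMap.smul_apply, smul_eq_mul] at this
    linear_combination (-1 / 2) * this

end InvariantForm

end

end RationalCherednik

/-! ### The sl₂ relations in a representation of the Cherednik relations -/

namespace RationalCherednik

open Module

noncomputable section

variable {V : Type*} [AddCommGroup V] [Module ℂ V]
variable {W : Subgroup (V ≃ₗ[ℂ] V)} (R : RootChoice W) (c : reflections W → ℂ)

/-- A representation of the generators and relations of `H_c(W)` on a complex vector space. -/
structure CherednikRep (M : Type*) [AddCommGroup M] [Module ℂ M] where
  grp : W → Module.End ℂ M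
  pos : Dual ℂ V →ₗ[ℂ] Module.End ℂ M
  mom : V →ₗ[ℂ] Module.End ℂ M
  grp_pos : ∀ g x, grp g * pos x = pos (dualAct g x) * grp g
  grp_mom : ∀ g y, grp g * mom y = mom ((g : V ≃ₗ[ℂ] V) y) * grp g
  pos_comm : ∀ x x', pos x * pos x' = pos x' * pos x
  mom_comm : ∀ y y', mom y * mom y' = mom y' * mom y
  mom_pos : ∀ y x, mom y * pos x - pos x * mom y =
    x y • 1 - ∑ᶠ s : reflections W, (c s * R.root s y * x (R.coroot s)) • grp s.1

section Identities

variable {A : Type*} [Ring A]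

theorem commutator_mul_self (a b : A) :
    b * (a * a) - a * a * b = a * (b * a - a * b) + (b * a - a * b) * a := by
  simp only [mul_sub, sub_mul, mul_assoc]; abel

theorem mul_self_commutator (b z : A) :
    b * b * z - z * (b * b) = b * (b * z - z * b) + (b * z - z * b) * b := by
  simp only [mul_sub, sub_mul, mul_assoc]; abel

theorem anticommutator_commutator (a b z : A) :
    (a * b + b * a) * z - z * (a * b + b * a) =
      (a * (b * z - z * b) + (b * z - z * b) * a) +
        (b * (a * z - z * a) + (a * z - z * a) * b) := by
  simp only [mul_add, add_mul, mul_sub, sub_mul, mul_assoc]; abel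

end Identities

namespace CherednikRep

variable {R c} {M : Type*} [AddCommGroup M] [Module ℂ M] (P : CherednikRep R c M)

theorem mom_pos_commutator [Fintype (reflections W)] (y : V) (x : Dual ℂ V) :
    P.mom y * P.pos x - P.pos x * P.mom y =
      x y • 1 - ∑ s : reflections W, (c s * R.root s y * x (R.coroot s)) • P.grp s.1 := by
  rw [P.mom_pos, finsum_eq_sum_of_fintype]

variable {n : ℕ} (F : InvariantForm W n)

/-- The position generator dual to the `i`-th basis vector. -/
def posCoord (i : Fin n) : Module.End ℂ M := P.pos (F.form (F.basis i))

/-- The momentum generator of the `i`-th basis vector. -/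
def momCoord (i : Fin n) : Module.End ℂ M := P.mom (F.basis i)

/-- The symmetrized Euler element. -/
def euler : Module.End ℂ M :=
  (1 / 2 : ℂ) • ∑ i, (P.posCoord F i * P.momCoord F i + P.momCoord F i * P.posCoord F i)

/-- The squared length of the position vector. -/
def posSq : Module.End ℂ M := ∑ i, P.posCoord F i * P.posCoord F i

/-- The squared length of the momentum vector. -/
def momSq : Module.End ℂ M := ∑ i, P.momCoord F i * P.momCoord F i

theorem sum_smul_pos (x : Dual ℂ V) : ∑ i, x (F.basis i) • P.posCoord F i = P.pos x := by
  conv_rhs => rw [← F.sum_apply_smul x]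
  simp only [map_sum, map_smul, posCoord]

theorem sum_smul_mom (y : V) : ∑ i, F.form y (F.basis i) • P.momCoord F i = P.mom y := by
  have h := congrArg P.mom (F.sum_form_smul y)
  simpa only [map_sum, map_smul, momCoord] using h

theorem pos_root_anticomm (F : InvariantForm W n) (s : reflections W) :
    P.pos (R.root s) * P.grp s.1 + P.grp s.1 * P.pos (R.root s) = 0 := by
  rw [P.grp_pos, (F.reflection_properties R s).2.1, map_neg, neg_mul, add_neg_cancel]

theorem mom_coroot_anticomm (F : InvariantForm W n) (s : reflections W) :
    P.mom (R.coroot s) * P.grp s.1 + P.grp s.1 * P.mom (R.coroot s) = 0 := by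
  rw [P.grp_mom, (F.reflection_properties R s).1, map_neg, neg_mul, add_neg_cancel]

/-- Coroots are proportional to roots through the form, so each reflection coefficient is symmetric
in y and v. This turns [y_j, x_i] into [y_i, x_j] when commuting ∑y_j² past x_i. -/
theorem commutator_symm [Fintype (reflections W)] (y v : V) :
    P.mom y * P.pos (F.form v) - P.pos (F.form v) * P.mom y =
      P.mom v * P.pos (F.form y) - P.pos (F.form y) * P.mom v := by
  rw [P.mom_pos_commutator, P.mom_pos_commutator, F.symm v y]
  congr 1
  refine Finset.sum_congr rfl fun s _ => ?_
  obtain ⟨k, hk⟩ := (F.reflection_properties R s).2.2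
  rw [F.symm v, F.symm y, hk, hk]
  congr 1
  ring

/-- Summing over the basis reassembles each reflection term into α_s s + s α_s, which vanishes
because s negates α_s. All dependence on c therefore cancels. -/
theorem sum_pos_commutator [Fintype (reflections W)] (x : Dual ℂ V) :
    ∑ i, (P.posCoord F i * (P.momCoord F i * P.pos x - P.pos x * P.momCoord F i) +
      (P.momCoord F i * P.pos x - P.pos x * P.momCoord F i) * P.posCoord F i) = (2 : ℂ) • P.pos x := by
  have h : ∀ i, P.posCoord F i * (P.momCoord F i * P.pos x - P.pos x * P.momCoord F i) +
      (P.momCoord F i * P.pos x - P.pos x * P.momCoord F i) * P.posCoord F i =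
      (2 : ℂ) • (x (F.basis i) • P.posCoord F i) - ∑ s : reflections W, (c s * x (R.coroot s)) •
        ((R.root s (F.basis i) • P.posCoord F i) * P.grp s.1 +
          P.grp s.1 * (R.root s (F.basis i) • P.posCoord F i)) := by
    intro i
    rw [momCoord, P.mom_pos_commutator, mul_sub, sub_mul, Finset.mul_sum, Finset.sum_mul, two_smul,
      mul_smul_comm, smul_mul_assoc, mul_one, one_mul, sub_add_sub_comm, ← Finset.sum_add_distrib]
    congr 1
    refine Finset.sum_congr rfl fun s _ => ?_
    simp only [mul_smul_comm, smul_mul_assoc, smul_add, smul_smul]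
    congr 2 <;> ring
  rw [Finset.sum_congr rfl fun i _ => h i, Finset.sum_sub_distrib, ← Finset.smul_sum,
    P.sum_smul_pos F, Finset.sum_comm]
  simp only [← Finset.smul_sum, Finset.sum_add_distrib, ← Finset.sum_mul, ← Finset.mul_sum,
    P.sum_smul_pos F, P.pos_root_anticomm F, smul_zero, Finset.sum_const_zero, sub_zero]

theorem sum_mom_commutator [Fintype (reflections W)] (y : V) :
    ∑ i, (P.momCoord F i * (P.mom y * P.posCoord F i - P.posCoord F i * P.mom y) +
      (P.mom y * P.posCoord F i - P.posCoord F i * P.mom y) * P.momCoord F i) = (2 : ℂ) • P.mom y := by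
  have h : ∀ i, P.momCoord F i * (P.mom y * P.posCoord F i - P.posCoord F i * P.mom y) +
      (P.mom y * P.posCoord F i - P.posCoord F i * P.mom y) * P.momCoord F i =
      (2 : ℂ) • (F.form y (F.basis i) • P.momCoord F i) -
        ∑ s : reflections W, (c s * R.root s y) •
        ((F.form (R.coroot s) (F.basis i) • P.momCoord F i) * P.grp s.1 +
          P.grp s.1 * (F.form (R.coroot s) (F.basis i) • P.momCoord F i)) := by
    intro i
    rw [posCoord, P.mom_pos_commutator, mul_sub, sub_mul, Finset.mul_sum, Finset.sum_mul, two_smul,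
      mul_smul_comm, smul_mul_assoc, mul_one, one_mul, sub_add_sub_comm, ← Finset.sum_add_distrib,
      F.symm (F.basis i) y]
    congr 1
    refine Finset.sum_congr rfl fun s _ => ?_
    simp only [mul_smul_comm, smul_mul_assoc, smul_add, smul_smul, F.symm (F.basis i)]
  rw [Finset.sum_congr rfl fun i _ => h i, Finset.sum_sub_distrib, ← Finset.smul_sum,
    P.sum_smul_mom F, Finset.sum_comm]
  simp only [← Finset.smul_sum, Finset.sum_add_distrib, ← Finset.sum_mul, ← Finset.mul_sum,
    P.sum_smul_mom F, P.mom_coroot_anticomm F, smul_zero, Finset.sum_const_zero, sub_zero]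

theorem euler_commutator_pos [Fintype (reflections W)] (x : Dual ℂ V) :
    P.euler F * P.pos x - P.pos x * P.euler F = P.pos x := by
  rw [euler, smul_mul_assoc, mul_smul_comm, ← smul_sub, Finset.sum_mul, Finset.mul_sum,
    ← Finset.sum_sub_distrib]
  have h : ∀ i, P.posCoord F i * P.pos x - P.pos x * P.posCoord F i = 0 := fun i =>
    sub_eq_zero.2 (P.pos_comm _ x)
  simp only [anticommutator_commutator, h, mul_zero, zero_mul, add_zero, P.sum_pos_commutator,
    smul_smul]
  norm_num

theorem euler_commutator_mom [Fintype (reflections W)] (y : V) :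
    P.euler F * P.mom y - P.mom y * P.euler F = - P.mom y := by
  rw [euler, smul_mul_assoc, mul_smul_comm, ← smul_sub, Finset.sum_mul, Finset.mul_sum,
    ← Finset.sum_sub_distrib]
  have h : ∀ i, P.momCoord F i * P.mom y - P.mom y * P.momCoord F i = 0 := fun i =>
    sub_eq_zero.2 (P.mom_comm _ y)
  have h' : ∀ i, P.posCoord F i * P.mom y - P.mom y * P.posCoord F i =
      -(P.mom y * P.posCoord F i - P.posCoord F i * P.mom y) := fun i => (neg_sub _ _).symm
  simp only [anticommutator_commutator, h, h', mul_zero, zero_mul, add_zero, zero_add, mul_neg,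
    neg_mul, ← neg_add, Finset.sum_neg_distrib, P.sum_mom_commutator, smul_neg, smul_smul]
  norm_num

theorem momSq_commutator_pos [Fintype (reflections W)] (i : Fin n) :
    P.momSq F * P.posCoord F i - P.posCoord F i * P.momSq F = (2 : ℂ) • P.momCoord F i := by
  rw [momSq, Finset.sum_mul, Finset.mul_sum, ← Finset.sum_sub_distrib, momCoord,
    ← P.sum_mom_commutator F]
  refine Finset.sum_congr rfl fun j _ => ?_
  rw [mul_self_commutator, momCoord, posCoord, P.commutator_symm F]
  rfl

theorem momSq_commutator_posSq [Fintype (reflections W)] :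
    P.momSq F * P.posSq F - P.posSq F * P.momSq F = (4 : ℂ) • P.euler F := by
  rw [posSq, Finset.sum_mul, Finset.mul_sum, ← Finset.sum_sub_distrib, euler, smul_smul,
    Finset.smul_sum]
  refine Finset.sum_congr rfl fun i _ => ?_
  rw [commutator_mul_self, momSq_commutator_pos, mul_smul_comm, smul_mul_assoc, ← smul_add]
  norm_num

theorem euler_commutator_posSq [Fintype (reflections W)] :
    P.euler F * P.posSq F - P.posSq F * P.euler F = 2 • P.posSq F := by
  rw [posSq, Finset.sum_mul, Finset.mul_sum, ← Finset.sum_sub_distrib, Finset.smul_sum]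
  refine Finset.sum_congr rfl fun i _ => ?_
  rw [commutator_mul_self, posCoord, euler_commutator_pos, two_nsmul]

theorem euler_commutator_momSq [Fintype (reflections W)] :
    P.euler F * P.momSq F - P.momSq F * P.euler F = -(2 • P.momSq F) := by
  rw [momSq, Finset.sum_mul, Finset.mul_sum, ← Finset.sum_sub_distrib, Finset.smul_sum,
    ← Finset.sum_neg_distrib]
  refine Finset.sum_congr rfl fun i _ => ?_
  rw [commutator_mul_self, momCoord, euler_commutator_mom, two_nsmul, mul_neg, neg_mul, ← neg_add]

attribute [local instance] LieRing.ofAssociativeRing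

/-- The `sl₂`-triple in the rational Cherednik algebra of a real reflection group. -/
theorem isSl2Triple [Fintype (reflections W)] (h : P.euler F ≠ 0) :
    IsSl2Triple (P.euler F) ((1 / 2 : ℂ) • P.posSq F) ((-1 / 2 : ℂ) • P.momSq F) where
  h_ne_zero := h
  lie_e_f := by
    rw [LieRing.of_associative_ring_bracket]
    simp only [smul_mul_assoc, mul_smul_comm, smul_smul]
    have := P.momSq_commutator_posSq F
    rw [show P.euler F = (1 / 4 : ℂ) • ((4 : ℂ) • P.euler F) by rw [smul_smul]; norm_num,
      ← this]
    module
  lie_h_e_nsmul := by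
    rw [LieRing.of_associative_ring_bracket, mul_smul_comm, smul_mul_assoc, ← smul_sub,
      euler_commutator_posSq, smul_comm]
  lie_h_f_nsmul := by
    rw [LieRing.of_associative_ring_bracket, mul_smul_comm, smul_mul_assoc, ← smul_sub,
      euler_commutator_momSq, smul_neg, smul_comm]

end CherednikRep

end

end RationalCherednik

/-! ### Weights of finite dimensional sl₂-representations -/

namespace RationalCherednik

open Module Polynomial

noncomputable section

section Sl2

attribute [local instance] LieRing.ofAssociativeRing

/-- A highest weight vector of weight `n` in a finite dimensional representation of `sl₂` is moved
by `f ^ n` to a nonzero vector of weight `-n`. -/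
theorem exists_lowest_weight_vector {M : Type*} [AddCommGroup M] [Module ℂ M]
    [FiniteDimensional ℂ M] {h e f : Module.End ℂ M} (t : IsSl2Triple h e f) {m : M} {μ : ℂ}
    (hm : m ≠ 0) (hh : h m = μ • m) (he : e m = 0) :
    ∃ k : ℕ, μ = k ∧ (f ^ k) m ≠ 0 ∧ h ((f ^ k) m) = (-μ) • (f ^ k) m := by
  have P : t.HasPrimitiveVectorWith m μ := ⟨hm, hh, he⟩
  obtain ⟨k, rfl⟩ := P.exists_nat
  have hne : ∀ j ≤ k, (f ^ j) m ≠ 0 := by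
    intro j
    induction j with
    | zero => intro _; simpa using hm
    | succ j ih =>
      intro hj h0
      have h1 := P.lie_e_pow_succ_toEnd_f j
      rw [LieModule.toEnd_module_end] at h1
      change e ((f ^ (j + 1)) m) = (((j : ℂ) + 1) * (k - j)) • (f ^ j) m at h1
      rw [h0, map_zero] at h1
      -- The coefficient (j + 1)(k - j) vanishes only at j = k, so below k the vector can be
      -- recovered by applying e.
      rcases smul_eq_zero.1 h1.symm with h2 | h2
      · rcases mul_eq_zero.1 h2 with h3 | h3
        · exact Nat.cast_add_one_ne_zero j h3
        · have : k = j := by exact_mod_cast sub_eq_zero.1 h3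
          omega
      · exact ih (by omega) h2
  refine ⟨k, rfl, hne k le_rfl, ?_⟩
  have h1 := P.lie_h_pow_toEnd_f k
  rw [LieModule.toEnd_module_end] at h1
  change h ((f ^ k) m) = ((k : ℂ) - 2 * k) • (f ^ k) m at h1
  rw [h1]
  congr 1
  ring

end Sl2

/-! ### The grading by degree and the Euler operator -/

variable {V : Type*} [AddCommGroup V] [Module ℂ V]
variable {W : Subgroup (V ≃ₗ[ℂ] V)} {R : RootChoice W} {c : reflections W → ℂ}

namespace CherednikRep

variable {M : Type*} [AddCommGroup M] [Module ℂ M] (P : CherednikRep R c M)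

/-- A subspace is a subrepresentation. -/
structure Invariant (N : Submodule ℂ M) : Prop where
  grp_mem : ∀ g, ∀ m ∈ N, P.grp g m ∈ N
  pos_mem : ∀ x, ∀ m ∈ N, P.pos x m ∈ N
  mom_mem : ∀ y, ∀ m ∈ N, P.mom y m ∈ N

/-- A generating vector fixed by the group and killed by the momenta. -/
structure IsLowestWeight (v : M) : Prop where
  grp_apply : ∀ g, P.grp g v = v
  mom_apply : ∀ y, P.mom y v = 0
  generates : ∀ N : Submodule ℂ M, P.Invariant N → v ∈ N → N = ⊤

/-- The image of the homogeneous polynomials of degree `d` acting on `v`. -/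
def layer (v : M) : ℕ → Submodule ℂ M
  | 0 => Submodule.span ℂ {v}
  | d + 1 => ⨆ x, (layer v d).map (P.pos x)

/-- The span of the layers with index in `S`. -/
def layers (v : M) (S : Set ℕ) : Submodule ℂ M := ⨆ d ∈ S, P.layer v d

theorem layer_le_layers (v : M) {S : Set ℕ} {d : ℕ} (hd : d ∈ S) :
    P.layer v d ≤ P.layers v S :=
  le_iSup₂_of_le d hd le_rfl

theorem layers_mono (v : M) {S T : Set ℕ} (h : S ⊆ T) : P.layers v S ≤ P.layers v T :=
  iSup₂_le fun _ hd => P.layer_le_layers v (h hd)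

theorem pos_mem_layer (v : M) (x : Dual ℂ V) {d : ℕ} {m : M} (hm : m ∈ P.layer v d) :
    P.pos x m ∈ P.layer v (d + 1) :=
  Submodule.mem_iSup_of_mem x (Submodule.mem_map_of_mem hm)

theorem layer_succ_induction {v : M} {d : ℕ} {T : Submodule ℂ M}
    (h : ∀ x, ∀ m ∈ P.layer v d, P.pos x m ∈ T) : P.layer v (d + 1) ≤ T :=
  iSup_le fun x => Submodule.map_le_iff_le_comap.2 fun m hm => h x m hm

theorem layers_induction {v : M} {S : Set ℕ} {T : Submodule ℂ M} {A : Module.End ℂ M}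
    (h : ∀ d ∈ S, ∀ m ∈ P.layer v d, A m ∈ T) {m : M} (hm : m ∈ P.layers v S) : A m ∈ T := by
  have : P.layers v S ≤ T.comap A := iSup₂_le fun d hd m hm => h d hd m hm
  exact this hm

theorem pos_mem_layers {v : M} (x : Dual ℂ V) {j : ℕ} {m : M}
    (hm : m ∈ P.layers v (Set.Ici j)) : P.pos x m ∈ P.layers v (Set.Ici (j + 1)) :=
  P.layers_induction (fun d hd _ hm' =>
    P.layer_le_layers v (show d + 1 ∈ Set.Ici (j + 1) from Nat.succ_le_succ hd)
      (P.pos_mem_layer v x hm')) hm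

variable {P} {v : M}

namespace IsLowestWeight

theorem grp_mem_layer (hv : P.IsLowestWeight v) (g : W) {d : ℕ} :
    ∀ m ∈ P.layer v d, P.grp g m ∈ P.layer v d := by
  induction d with
  | zero =>
    intro m hm
    obtain ⟨a, rfl⟩ := Submodule.mem_span_singleton.1 hm
    rw [map_smul, hv.grp_apply]
    exact hm
  | succ d ih =>
    refine P.layer_succ_induction (T := (P.layer v (d + 1)).comap (P.grp g)) fun x m hm => ?_
    rw [Submodule.mem_comap, ← Module.End.mul_apply, P.grp_pos, Module.End.mul_apply]
    exact P.pos_mem_layer v _ (ih m hm)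

theorem mom_layer_zero (hv : P.IsLowestWeight v) (y : V) {m : M} (hm : m ∈ P.layer v 0) :
    P.mom y m = 0 := by
  obtain ⟨a, rfl⟩ := Submodule.mem_span_singleton.1 hm
  rw [map_smul, hv.mom_apply, smul_zero]

/-- Moving y past one x costs a combination of 1 and reflections, which preserve each layer; the
remaining term x y m is handled by induction on the degree. -/
theorem mom_mem_layer [Fintype (reflections W)] (hv : P.IsLowestWeight v) (y : V) {d : ℕ} :
    ∀ m ∈ P.layer v (d + 1), P.mom y m ∈ P.layer v d := by
  have key : ∀ (x : Dual ℂ V) (d : ℕ), ∀ m ∈ P.layer v d, P.pos x (P.mom y m) ∈ P.layer v d →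
      P.mom y (P.pos x m) ∈ P.layer v d := by
    intro x d m hm hm'
    have h := LinearMap.congr_fun (P.mom_pos_commutator y x) m
    simp only [LinearMap.sub_apply, Module.End.mul_apply, LinearMap.smul_apply,
      LinearMap.sum_apply, Module.End.one_apply] at h
    rw [sub_eq_iff_eq_add.1 h]
    refine add_mem (sub_mem (Submodule.smul_mem _ _ hm) (sum_mem fun s _ =>
      Submodule.smul_mem _ _ (hv.grp_mem_layer _ m hm))) hm'
  induction d with
  | zero =>
    refine P.layer_succ_induction (T := (P.layer v 0).comap (P.mom y)) fun x m hm => ?_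
    refine key x 0 m hm ?_
    rw [hv.mom_layer_zero y hm, map_zero]
    exact zero_mem _
  | succ d ih =>
    refine P.layer_succ_induction (T := (P.layer v (d + 1)).comap (P.mom y)) fun x m hm => ?_
    exact key x (d + 1) m hm (P.pos_mem_layer v x (ih m hm))

theorem layers_univ [Fintype (reflections W)] (hv : P.IsLowestWeight v) :
    P.layers v Set.univ = ⊤ := by
  refine hv.generates _ ⟨fun g m hm => ?_, fun x m hm => ?_, fun y m hm => ?_⟩
    (P.layer_le_layers v (Set.mem_univ 0) (Submodule.mem_span_singleton_self v))
  · exact P.layers_induction (fun d _ m' hm' =>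
      P.layer_le_layers v (Set.mem_univ d) (hv.grp_mem_layer g m' hm')) hm
  · exact P.layers_induction (fun d _ m' hm' =>
      P.layer_le_layers v (Set.mem_univ (d + 1)) (P.pos_mem_layer v x hm')) hm
  · refine P.layers_induction (fun d _ m' hm' => ?_) hm
    cases d with
    | zero => rw [hv.mom_layer_zero y hm']; exact zero_mem _
    | succ d => exact P.layer_le_layers v (Set.mem_univ d) (hv.mom_mem_layer y m' hm')

theorem exists_add_mem_layers [Fintype (reflections W)] (hv : P.IsLowestWeight v) (m : M) :
    ∃ a : ℂ, ∃ m' ∈ P.layers v (Set.Ici 1), m = a • v + m' := by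
  have h : (⊤ : Submodule ℂ M) ≤ P.layer v 0 ⊔ P.layers v (Set.Ici 1) := by
    rw [← hv.layers_univ]
    refine iSup₂_le fun d _ => ?_
    cases d with
    | zero => exact le_sup_left
    | succ d => exact (P.layer_le_layers v (Nat.succ_le_succ (Nat.zero_le d))).trans le_sup_right
  obtain ⟨u, hu, m', hm', rfl⟩ := Submodule.mem_sup.1 (h (Submodule.mem_top (x := m)))
  obtain ⟨a, rfl⟩ := Submodule.mem_span_singleton.1 hu
  exact ⟨a, m', hm', rfl⟩

variable {n : ℕ} (F : InvariantForm W n)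

theorem exists_euler_apply [Fintype (reflections W)] (hv : P.IsLowestWeight v) :
    ∃ κ : ℂ, P.euler F v = κ • v := by
  have h : P.euler F v ∈ P.layer v 0 := by
    have hv0 : v ∈ P.layer v 0 := Submodule.mem_span_singleton_self v
    rw [euler, LinearMap.smul_apply, LinearMap.sum_apply]
    refine Submodule.smul_mem _ _ (sum_mem fun i _ => ?_)
    rw [LinearMap.add_apply, Module.End.mul_apply, Module.End.mul_apply, momCoord,
      hv.mom_apply, map_zero, zero_add]
    exact hv.mom_mem_layer _ _ (P.pos_mem_layer v _ hv0)
  obtain ⟨κ, hκ⟩ := Submodule.mem_span_singleton.1 h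
  exact ⟨κ, hκ.symm⟩

end IsLowestWeight

variable {n : ℕ} {F : InvariantForm W n} {κ : ℂ}

theorem euler_apply_layer [Fintype (reflections W)] (hκ : P.euler F v = κ • v) {d : ℕ} :
    ∀ m ∈ P.layer v d, P.euler F m = (κ + d) • m := by
  induction d with
  | zero =>
    intro m hm
    obtain ⟨a, rfl⟩ := Submodule.mem_span_singleton.1 hm
    rw [map_smul, hκ, smul_comm, Nat.cast_zero, add_zero]
  | succ d ih =>
    have : P.layer v (d + 1) ≤ LinearMap.ker (P.euler F - (κ + (d + 1 : ℕ)) • 1) := by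
      refine P.layer_succ_induction fun x m hm => ?_
      have h := LinearMap.congr_fun (P.euler_commutator_pos F x) m
      simp only [LinearMap.sub_apply, Module.End.mul_apply] at h
      rw [ih m hm, map_smul, sub_eq_iff_eq_add] at h
      rw [LinearMap.mem_ker, LinearMap.sub_apply, h, LinearMap.smul_apply, Module.End.one_apply]
      push_cast
      module
    intro m hm
    have h := this hm
    rwa [LinearMap.mem_ker, LinearMap.sub_apply, sub_eq_zero] at h

theorem aeval_apply_of_eigen {A : Module.End ℂ M} {μ : ℂ} {m : M} (h : A m = μ • m) (p : ℂ[X]) :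
    aeval A p m = p.eval μ • m := by
  by_cases hm : m = 0
  · simp [hm]
  · exact Module.End.aeval_apply_of_hasEigenvector
      ⟨Module.End.mem_eigenspace_iff.2 h, hm⟩

/-- A substitute for projections onto graded pieces, valid also in infinite dimension: products of
factors X - (κ + d) kill sums of layers, and evaluating them on an eigenvector pins down its
eigenvalue. -/
theorem exists_aeval_euler_eq_zero [Fintype (reflections W)] (hκ : P.euler F v = κ • v)
    (S : Set ℕ) {m : M} (hm : m ∈ P.layers v S) :
    ∃ p : ℂ[X], p ≠ 0 ∧ (∀ z, p.IsRoot z → ∃ d ∈ S, z = κ + d) ∧ aeval (P.euler F) p m = 0 := by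
  have hm' : m ∈ ⨆ d : S, P.layer v d := by rwa [layers, iSup_subtype'] at hm
  induction hm' using Submodule.iSup_induction' with
  | mem d m hd =>
    refine ⟨X - C (κ + d.1), X_sub_C_ne_zero _, fun z hz => ⟨d, d.2, root_X_sub_C.1 hz ▸ rfl⟩, ?_⟩
    rw [aeval_apply_of_eigen (euler_apply_layer hκ m hd)]
    simp
  | zero => exact ⟨1, one_ne_zero, fun z hz => by simp at hz, by simp⟩
  | add m₁ m₂ h₁ h₂ ih₁ ih₂ =>
    have e : (⨆ d : S, P.layer v d) = P.layers v S := by rw [layers, iSup_subtype']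
    obtain ⟨p, hp0, hp, hpm⟩ := ih₁ (e ▸ h₁)
    obtain ⟨q, hq0, hq, hqm⟩ := ih₂ (e ▸ h₂)
    refine ⟨p * q, mul_ne_zero hp0 hq0, fun z hz => ?_, ?_⟩
    · exact (root_mul.1 hz).elim (hp z) (hq z)
    · rw [map_add, map_mul, Module.End.mul_apply, Module.End.mul_apply, hqm, map_zero, add_zero,
        ← Module.End.mul_apply, ← map_mul, mul_comm, map_mul, Module.End.mul_apply, hpm, map_zero]

theorem exists_eq_of_eigen [Fintype (reflections W)] (hκ : P.euler F v = κ • v) {S : Set ℕ}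
    {m : M} (hm : m ∈ P.layers v S) (hm0 : m ≠ 0) {μ : ℂ} (hμ : P.euler F m = μ • m) :
    ∃ d ∈ S, μ = κ + d := by
  obtain ⟨p, -, hp, hpm⟩ := exists_aeval_euler_eq_zero hκ S hm
  rw [aeval_apply_of_eigen hμ] at hpm
  exact hp μ ((smul_eq_zero.1 hpm).resolve_right hm0)

theorem exists_eval_ne_zero [Fintype (reflections W)] (hκ : P.euler F v = κ • v)
    {m : M} (hm : m ∈ P.layers v (Set.Ici 1)) :
    ∃ p : ℂ[X], p.eval κ ≠ 0 ∧ aeval (P.euler F) p m = 0 := by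
  obtain ⟨p, -, hp, hpm⟩ := exists_aeval_euler_eq_zero hκ _ hm
  refine ⟨p, fun h => ?_, hpm⟩
  obtain ⟨d, hd, he⟩ := hp κ h
  have : (d : ℂ) = 0 := by linear_combination -he
  rw [Nat.cast_eq_zero] at this
  rw [this] at hd
  exact absurd hd (by simp)

theorem notMem_layers_of_ne_zero [Fintype (reflections W)] (hκ : P.euler F v = κ • v)
    (hv0 : v ≠ 0) : v ∉ P.layers v (Set.Ici 1) := by
  intro h
  obtain ⟨d, hd, he⟩ := exists_eq_of_eigen hκ h hv0 hκ
  have : (d : ℂ) = 0 := by linear_combination -he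
  rw [Nat.cast_eq_zero] at this
  rw [this] at hd
  exact absurd hd (by simp)

/-- Split off the degree 0 part. A polynomial in the Euler operator that kills the positive part,
but has nonzero value at κ, leaves only the multiple of v. -/
theorem IsLowestWeight.eq_smul_of_eigen [Fintype (reflections W)] (hv : P.IsLowestWeight v)
    (hκ : P.euler F v = κ • v) {m : M} (hm : P.euler F m = κ • m) : ∃ a : ℂ, m = a • v := by
  obtain ⟨a, m', hm', rfl⟩ := hv.exists_add_mem_layers m
  obtain ⟨p, hp, hpm⟩ := exists_eval_ne_zero hκ hm'
  have h := aeval_apply_of_eigen hm p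
  rw [map_add, map_smul, aeval_apply_of_eigen hκ, hpm, add_zero, smul_comm] at h
  exact ⟨a, (smul_right_injective M hp h).symm⟩

theorem Invariant.euler_mem {N : Submodule ℂ M} (hN : P.Invariant N) :
    ∀ m ∈ N, P.euler F m ∈ N := by
  intro m hm
  rw [euler, LinearMap.smul_apply, LinearMap.sum_apply]
  refine Submodule.smul_mem _ _ (sum_mem fun i _ => add_mem ?_ ?_)
  · exact hN.pos_mem _ _ (hN.mom_mem _ _ hm)
  · exact hN.mom_mem _ _ (hN.pos_mem _ _ hm)

theorem Invariant.momSq_mem {N : Submodule ℂ M} (hN : P.Invariant N) :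
    ∀ m ∈ N, P.momSq F m ∈ N := by
  intro m hm
  rw [momSq, LinearMap.sum_apply]
  exact sum_mem fun i _ => hN.mom_mem _ _ (hN.mom_mem _ _ hm)

theorem aeval_mem {A : Module.End ℂ M} {N : Submodule ℂ M} (h : ∀ m ∈ N, A m ∈ N) (p : ℂ[X])
    {m : M} (hm : m ∈ N) : aeval A p m ∈ N := by
  induction p using Polynomial.induction_on' with
  | add p q hp hq => rw [map_add, LinearMap.add_apply]; exact add_mem hp hq
  | monomial k a =>
    rw [aeval_monomial, Algebra.algebraMap_eq_smul_one, smul_mul_assoc, one_mul,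
      LinearMap.smul_apply]
    refine N.smul_mem _ ?_
    induction k with
    | zero => simpa using hm
    | succ k ih => rw [pow_succ', Module.End.mul_apply]; exact h _ ih

/-- A proper subrepresentation has no component of degree zero. -/
theorem IsLowestWeight.le_layers [Fintype (reflections W)] (hv : P.IsLowestWeight v)
    (hκ : P.euler F v = κ • v) {N : Submodule ℂ M} (hN : P.Invariant N) (hNv : v ∉ N) :
    N ≤ P.layers v (Set.Ici 1) := by
  intro m hm
  obtain ⟨a, m', hm', rfl⟩ := hv.exists_add_mem_layers m
  by_cases ha : a = 0
  · simpa [ha] using hm'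
  obtain ⟨p, hp, hpm⟩ := exists_eval_ne_zero hκ hm'
  have h := aeval_mem (hN.euler_mem (F := F)) p hm
  rw [map_add, map_smul, aeval_apply_of_eigen hκ, hpm, add_zero, smul_smul] at h
  exact absurd ((N.smul_mem_iff (mul_ne_zero ha hp)).1 h) hNv

end CherednikRep

/-! ### Socle and top degree: the sl₂ argument -/

namespace CherednikRep

variable {M : Type*} [AddCommGroup M] [Module ℂ M] {P : CherednikRep R c M}
variable {v : M} {n : ℕ} {F : InvariantForm W n} {κ : ℂ}

/-- Nonzero layers give distinct eigenvalues κ + d, of which there are finitely many. -/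
theorem exists_top_layer [FiniteDimensional ℂ M] [Fintype (reflections W)]
    (hκ : P.euler F v = κ • v) (hv0 : v ≠ 0) :
    ∃ D, P.layer v D ≠ ⊥ ∧ P.layers v (Set.Ici (D + 1)) = ⊥ := by
  have hfin : {d : ℕ | P.layer v d ≠ ⊥}.Finite := by
    refine Set.Finite.subset ((P.euler F).finite_hasEigenvalue.preimage
      (f := fun d : ℕ => κ + d) (fun a _ b _ h => ?_)) fun d hd => ?_
    · exact_mod_cast add_left_cancel h
    · obtain ⟨m, hm, hm0⟩ := Submodule.exists_mem_ne_zero_of_ne_bot hd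
      exact Module.End.hasEigenvalue_of_hasEigenvector
        ⟨Module.End.mem_eigenspace_iff.2 (euler_apply_layer hκ m hm), hm0⟩
  obtain ⟨D, hD, hmax⟩ := Set.exists_max_image _ id hfin
    ⟨0, by simpa [layer, Submodule.span_singleton_eq_bot] using hv0⟩
  refine ⟨D, hD, ?_⟩
  rw [layers, iSup₂_eq_bot]
  intro d hd
  by_contra h
  exact absurd (hmax d h) (not_le.2 (Nat.lt_of_succ_le hd))

theorem Invariant.exists_socle [Fintype (reflections W)]
    (hv : P.IsLowestWeight v) {D : ℕ} (hD : P.layers v (Set.Ici (D + 1)) = ⊥)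
    {N : Submodule ℂ M} (hN : P.Invariant N) (hN0 : N ≠ ⊥) :
    ∃ m ∈ N, m ≠ 0 ∧ ∀ x, P.pos x m = 0 := by
  -- A vector not yet in the socle is moved up one degree by some x, which lowers k by one; at k = 0
  -- nothing nonzero is left. The start k = D + 1 imposes no condition.
  have key : ∀ k, ∀ m ∈ N, m ≠ 0 → m ∈ P.layers v (Set.Ici (D + 1 - k)) →
      ∃ m ∈ N, m ≠ 0 ∧ ∀ x, P.pos x m = 0 := by
    intro k
    induction k with
    | zero =>
      intro m _ hm0 hm
      rw [Nat.sub_zero, hD, Submodule.mem_bot] at hm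
      exact absurd hm hm0
    | succ k ih =>
      intro m hm hm0 hmk
      by_cases h : ∀ x, P.pos x m = 0
      · exact ⟨m, hm, hm0, h⟩
      · obtain ⟨x, hx⟩ := not_forall.1 h
        refine ih _ (hN.pos_mem x m hm) hx (P.layers_mono v ?_ (P.pos_mem_layers x hmk))
        exact Set.Ici_subset_Ici.2 (by omega)
  obtain ⟨m, hm, hm0⟩ := Submodule.exists_mem_ne_zero_of_ne_bot hN0
  refine key (D + 1) m hm hm0 ?_
  have : Set.Ici (D + 1 - (D + 1)) = (Set.univ : Set ℕ) := by ext; simp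
  rw [this, hv.layers_univ]
  exact Submodule.mem_top

attribute [local instance] LieRing.ofAssociativeRing in
/-- If the socle is detected by a single functional, so that it is at most one dimensional, then
every nonzero subrepresentation contains the lowest weight vector. -/
theorem Invariant.lowestWeight_mem [FiniteDimensional ℂ M] [Fintype (reflections W)]
    (F : InvariantForm W n) (hv : P.IsLowestWeight v) (φ : Dual ℂ M)
    (hφ : ∀ m, (∀ x, P.pos x m = 0) → φ m = 0 → m = 0)
    {N : Submodule ℂ M} (hN : P.Invariant N) (hN0 : N ≠ ⊥) : v ∈ N := by
  by_cases hv0 : v = 0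
  · rw [hv0]; exact zero_mem _
  obtain ⟨κ, hκ⟩ := hv.exists_euler_apply F
  obtain ⟨D, hD, hD'⟩ := exists_top_layer hκ hv0
  obtain ⟨m, hmN, hm0, hm⟩ := hN.exists_socle hv hD' hN0
  obtain ⟨u, huD, hu0⟩ := Submodule.exists_mem_ne_zero_of_ne_bot hD
  have hu : ∀ x, P.pos x u = 0 := fun x => by
    have := P.layer_le_layers v (Set.self_mem_Ici (a := D + 1))
      (P.pos_mem_layer v x huD)
    rwa [hD', Submodule.mem_bot] at this
  have huN : u ∈ N := by
    -- This combination lies in the socle and in the kernel of φ.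
    have h : φ m • u - φ u • m = 0 := by
      refine hφ _ (fun x => ?_) ?_
      · rw [map_sub, map_smul, map_smul, hu, hm, smul_zero, smul_zero, sub_zero]
      · rw [map_sub, map_smul, map_smul, smul_eq_mul, smul_eq_mul, mul_comm, sub_self]
    have hφm : φ m ≠ 0 := fun h0 => hm0 (hφ m hm h0)
    rw [← N.smul_mem_iff hφm, sub_eq_zero.1 h]
    exact N.smul_mem _ hmN
  have heig := euler_apply_layer hκ u huD
  -- `IsSl2Triple` requires a nonzero h. If the Euler operator vanishes, everything has degree 0 and
  -- u is already a multiple of v.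
  by_cases h0 : P.euler F = 0
  · have hκ0 : κ = 0 := by
      rw [h0, LinearMap.zero_apply] at hκ
      exact (smul_eq_zero.1 hκ.symm).resolve_right hv0
    obtain ⟨a, rfl⟩ := hv.eq_smul_of_eigen hκ (m := u) (by rw [h0, hκ0]; simp)
    exact (N.smul_mem_iff (fun ha => hu0 (by rw [ha, zero_smul]))).1 huN
  have t := P.isSl2Triple F h0
  have hall : P.layers v (Set.Iic D) = ⊤ := by
    rw [eq_top_iff, ← hv.layers_univ]
    refine iSup₂_le fun d _ => ?_
    rcases le_or_gt d D with h | h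
    · exact P.layer_le_layers v h
    · exact (P.layer_le_layers v (show d ∈ Set.Ici (D + 1) from h)).trans (hD' ▸ bot_le)
  have hupper : ∀ m : M, m ≠ 0 → ∀ μ : ℂ, P.euler F m = μ • m → ∃ d ≤ D, μ = κ + d :=
    fun m hm0 μ hμ => exists_eq_of_eigen hκ (hall ▸ Submodule.mem_top) hm0 hμ
  obtain ⟨k, hk, hk0, hke⟩ := exists_lowest_weight_vector t hu0 heig (by
    rw [LinearMap.smul_apply, posSq, LinearMap.sum_apply]
    simp [Module.End.mul_apply, posCoord, hu])
  -- In the reversed triple, with -h in place of h, v is a highest weight vector of weight -κ; its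
  -- lowest weight vector has h-eigenvalue -κ.
  obtain ⟨l, hl, hl0, hle⟩ := exists_lowest_weight_vector t.symm hv0
    (show (-P.euler F) v = (-κ) • v by rw [LinearMap.neg_apply, hκ, neg_smul]) (by
    rw [LinearMap.smul_apply, momSq, LinearMap.sum_apply]
    simp [Module.End.mul_apply, momCoord, hv.mom_apply])
  obtain ⟨d, -, hd⟩ := hupper _ hk0 _ hke
  obtain ⟨d', hd'D, hd'⟩ := hupper _ hl0 (-κ) (by
    rw [LinearMap.neg_apply, neg_neg] at hle
    rw [← neg_inj, hle, neg_smul, neg_neg])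
  -- The weights -(κ + D) = κ + d and -κ = κ + d' differ by D; since d' ≤ D, this leaves d = 0.
  have hdd : d' = D + d := by
    have : (d' : ℂ) = (D + d : ℕ) := by push_cast; linear_combination hd - hd'
    exact_mod_cast this
  have hd0 : d = 0 := by omega
  rw [hd, hd0, Nat.cast_zero, add_zero] at hke
  obtain ⟨a, ha⟩ := hv.eq_smul_of_eigen hκ hke
  have hmem : ∀ k : ℕ, (((-1 / 2 : ℂ) • P.momSq F) ^ k) u ∈ N := by
    intro k
    induction k with
    | zero => simpa using huN
    | succ k ih =>
      rw [pow_succ', Module.End.mul_apply, LinearMap.smul_apply]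
      exact N.smul_mem _ (hN.momSq_mem _ ih)
  have ha0 : a ≠ 0 := fun h => hk0 (by rw [ha, h, zero_smul])
  rw [← N.smul_mem_iff ha0, ← ha]
  exact hmem k

end CherednikRep

/-! ### From modules over the Cherednik algebra to representations -/

section OfModule

variable (R c)

/-- The representation underlying a module over `H_c(W)`. -/
def repOfModule [Fintype (reflections W)] (M : Type*) [AddCommGroup M] [Module ℂ M] [Module (CherednikAlgebra R c) M]
    [IsScalarTower ℂ (CherednikAlgebra R c) M] : CherednikRep R c M :=
  let ρ : FreeAlgebra ℂ (Gen W) →ₐ[ℂ] Module.End ℂ M :=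
    (Algebra.lsmul ℂ ℂ M).comp (RingQuot.mkAlgHom ℂ (Rel R c))
  have hρ : ∀ {a b}, Rel R c a b → ρ a = ρ b := fun h =>
    congrArg (Algebra.lsmul ℂ ℂ M) (RingQuot.mkAlgHom_rel ℂ h)
  have inv : ∀ g : W, ρ (fg g⁻¹) * ρ (fg g) = 1 := fun g => by
    rw [← map_mul, ← hρ (Rel.grp_mul g⁻¹ g), inv_mul_cancel, hρ Rel.grp_one, map_one]
  { grp := fun g => ρ (fg g)
    pos :=
      { toFun := fun x => ρ (fx x)
        map_add' := fun x x' => by rw [hρ (Rel.pos_add x x'), map_add]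
        map_smul' := fun a x => by rw [hρ (Rel.pos_smul a x), map_smul, RingHom.id_apply] }
    mom :=
      { toFun := fun y => ρ (fy y)
        map_add' := fun y y' => by rw [hρ (Rel.mom_add y y'), map_add]
        map_smul' := fun a y => by rw [hρ (Rel.mom_smul a y), map_smul, RingHom.id_apply] }
    grp_pos := fun g x => by
      have h := hρ (Rel.grp_pos g x)
      rw [map_mul, map_mul] at h
      change _ = ρ (fx (dualAct g x)) * _
      rw [← h, mul_assoc, inv, mul_one]
      rfl
    grp_mom := fun g y => by
      have h := hρ (Rel.grp_mom g y)
      rw [map_mul, map_mul] at h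
      change _ = ρ (fy ((g : V ≃ₗ[ℂ] V) y)) * _
      rw [← h, mul_assoc, inv, mul_one]
      rfl
    pos_comm := fun x x' => by
      have h := hρ (Rel.pos_comm x x')
      rwa [map_mul, map_mul] at h
    mom_comm := fun y y' => by
      have h := hρ (Rel.mom_comm y y')
      rwa [map_mul, map_mul] at h
    mom_pos := fun y x => by
      have h := hρ (Rel.mom_pos y x)
      rw [finsum_eq_sum_of_fintype] at h ⊢
      simp only [map_sub, map_mul, map_sum, map_smul, Algebra.algebraMap_eq_smul_one,
        map_one] at h
      exact h }

end OfModule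

section OfModule

variable {M : Type*} [AddCommGroup M] [Module ℂ M]
  [Module (CherednikAlgebra R c) M] [IsScalarTower ℂ (CherednikAlgebra R c) M]

/-- On a socle vector only the constant term of a polynomial acts. -/
theorem polyMap_smul_of_socle {m : M} (hm : ∀ x, hx R c x • m = 0) (f : Poly V) :
    ∃ a : ℂ, polyMap R c f • m = a • m := by
  induction f using SymmetricAlgebra.induction with
  | algebraMap r => exact ⟨r, by rw [AlgHom.commutes, algebraMap_smul]⟩
  | ι x => exact ⟨0, by rw [polyMap_ι, hm, zero_smul]⟩
  | mul f g hf hg =>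
    obtain ⟨a, ha⟩ := hf
    obtain ⟨b, hb⟩ := hg
    exact ⟨b * a, by rw [map_mul, mul_smul, hb, smul_algebra_smul_comm, ha, mul_smul]⟩
  | add f g hf hg =>
    obtain ⟨a, ha⟩ := hf
    obtain ⟨b, hb⟩ := hg
    exact ⟨a + b, by rw [map_add, add_smul, ha, hb, add_smul]⟩

/-- The action of polynomials on a vector. -/
def polyAct (v : M) : Poly V →ₗ[ℂ] M :=
  (LinearMap.toSpanSingleton (CherednikAlgebra R c) M v).restrictScalars ℂ ∘ₗ
    (polyMap R c).toLinearMap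

theorem polyAct_apply (v : M) (f : Poly V) : polyAct (R := R) (c := c) v f = polyMap R c f • v :=
  rfl

variable [Fintype (reflections W)]

theorem invariant_restrictScalars (N : Submodule (CherednikAlgebra R c) M) :
    (repOfModule R c M).Invariant (N.restrictScalars ℂ) :=
  ⟨fun _ _ hm => N.smul_mem _ hm, fun _ _ hm => N.smul_mem _ hm, fun _ _ hm => N.smul_mem _ hm⟩

theorem CherednikRep.Invariant.smul_mem {N : Submodule ℂ M}
    (hN : (repOfModule R c M).Invariant N) (a : CherednikAlgebra R c) :
    ∀ m ∈ N, a • m ∈ N := by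
  obtain ⟨t, rfl⟩ := RingQuot.mkAlgHom_surjective ℂ (Rel R c) a
  induction t with
  | grade0 r =>
    intro m hm
    rw [AlgHom.commutes, algebraMap_smul]
    exact N.smul_mem r hm
  | grade1 z =>
    cases z with
    | grp g => exact hN.grp_mem g
    | pos x => exact hN.pos_mem x
    | mom y => exact hN.mom_mem y
  | mul a b ha hb => intro m hm; rw [map_mul, mul_smul]; exact ha _ (hb m hm)
  | add a b ha hb => intro m hm; rw [map_add, add_smul]; exact add_mem (ha m hm) (hb m hm)

theorem isLowestWeight_repOfModule {v : M} (hg_v : ∀ g, hg R c g • v = v)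
    (hy_v : ∀ y, hy R c y • v = 0) (hgen : ∀ m : M, ∃ a : CherednikAlgebra R c, a • v = m) :
    (repOfModule R c M).IsLowestWeight v where
  grp_apply := hg_v
  mom_apply := hy_v
  generates N hN hvN := by
    refine eq_top_iff.2 fun m _ => ?_
    obtain ⟨a, rfl⟩ := hgen m
    exact hN.smul_mem a v hvN

theorem polyAct_surjective {v : M} (hv : (repOfModule R c M).IsLowestWeight v) :
    Function.Surjective (polyAct (R := R) (c := c) v) := by
  rw [← LinearMap.range_eq_top, eq_top_iff, ← hv.layers_univ]
  refine iSup₂_le fun d _ => ?_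
  induction d with
  | zero =>
    refine (Submodule.span_singleton_le_iff_mem _ _).2 ⟨1, ?_⟩
    rw [polyAct_apply, map_one, one_smul]
  | succ d ih =>
    refine CherednikRep.layer_succ_induction _ fun x m hm => ?_
    obtain ⟨f, rfl⟩ := ih (Set.mem_univ d) hm
    refine ⟨SymmetricAlgebra.ι ℂ (Dual ℂ V) x * f, ?_⟩
    rw [polyAct_apply, map_mul, mul_smul, polyMap_ι]
    rfl

end OfModule

/-! ### Submodules of the polynomial representation -/

theorem hg_smul_vac (g : W) : hg R c g • vac R c = vac R c := by
  have h : hg R c g - 1 ∈ lowestWeightIdeal R c :=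
    Submodule.subset_span (Or.inr ⟨g, rfl⟩)
  rw [vac, ← Submodule.Quotient.mk_smul, Submodule.Quotient.eq, smul_eq_mul, mul_one]
  exact h

theorem hy_smul_vac (y : V) : hy R c y • vac R c = 0 := by
  have h : hy R c y ∈ lowestWeightIdeal R c :=
    Submodule.subset_span (Or.inl ⟨y, rfl⟩)
  rw [vac, ← Submodule.Quotient.mk_smul, Submodule.Quotient.mk_eq_zero, smul_eq_mul, mul_one]
  exact h

theorem exists_smul_vac (m : PolyRep R c) : ∃ a : CherednikAlgebra R c, a • vac R c = m := by
  obtain ⟨a, rfl⟩ := Submodule.Quotient.mk_surjective _ m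
  exact ⟨a, by rw [vac, ← Submodule.Quotient.mk_smul, smul_eq_mul, mul_one]⟩

theorem eq_top_of_vac_mem {N : Submodule (CherednikAlgebra R c) (PolyRep R c)}
    (h : vac R c ∈ N) : N = ⊤ := by
  refine eq_top_iff.2 fun m _ => ?_
  obtain ⟨a, rfl⟩ := exists_smul_vac m
  exact N.smul_mem a h

theorem isLowestWeight_vac [Fintype (reflections W)] :
    (repOfModule R c (PolyRep R c)).IsLowestWeight (vac R c) :=
  isLowestWeight_repOfModule hg_smul_vac hy_smul_vac exists_smul_vac

theorem isLowestWeight_mk_vac [Fintype (reflections W)]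
    (J : Submodule (CherednikAlgebra R c) (PolyRep R c)) :
    (repOfModule R c (PolyRep R c ⧸ J)).IsLowestWeight (J.mkQ (vac R c)) := by
  refine isLowestWeight_repOfModule (fun g => ?_) (fun y => ?_) fun m => ?_
  · rw [← map_smul, hg_smul_vac]
  · rw [← map_smul, hy_smul_vac, map_zero]
  · obtain ⟨m, rfl⟩ := J.mkQ_surjective m
    obtain ⟨a, rfl⟩ := exists_smul_vac m
    exact ⟨a, (map_smul _ _ _).symm⟩

/-- The sum of two proper submodules of the polynomial representation is proper. -/
theorem sup_ne_top [Fintype (reflections W)] {n : ℕ} (F : InvariantForm W n)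
    {N N' : Submodule (CherednikAlgebra R c) (PolyRep R c)} (hN : N ≠ ⊤) (hN' : N' ≠ ⊤) :
    N ⊔ N' ≠ ⊤ := by
  intro h
  have hv := isLowestWeight_vac (R := R) (c := c)
  obtain ⟨κ, hκ⟩ := hv.exists_euler_apply F
  have hv0 : vac R c ≠ 0 := fun h0 => hN (eq_top_of_vac_mem (h0 ▸ zero_mem N))
  have hle : ∀ L : Submodule (CherednikAlgebra R c) (PolyRep R c), L ≠ ⊤ →
      L.restrictScalars ℂ ≤ (repOfModule R c (PolyRep R c)).layers (vac R c) (Set.Ici 1) :=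
    fun L hL => hv.le_layers hκ (invariant_restrictScalars L) fun hm => hL (eq_top_of_vac_mem hm)
  obtain ⟨a, ha, b, hb, hab⟩ := Submodule.mem_sup.1 (h ▸ Submodule.mem_top : vac R c ∈ N ⊔ N')
  have hmem := add_mem (hle N hN ha) (hle N' hN' hb)
  rw [hab] at hmem
  exact CherednikRep.notMem_layers_of_ne_zero hκ hv0 hmem

theorem eq_maxSubmodule_of_isCoatom [Fintype (reflections W)] {n : ℕ} (F : InvariantForm W n)
    {J : Submodule (CherednikAlgebra R c) (PolyRep R c)} (hJ : IsCoatom J) :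
    J = maxSubmodule R c := by
  refine le_antisymm (le_sSup hJ.1) (sSup_le fun N hN => ?_)
  by_contra h
  exact sup_ne_top F hJ.1 hN (hJ.2 _ (left_lt_sup.2 h))

/-! ### The Gorenstein functional and the conclusion -/

/-- The generator of the dual of a Gorenstein quotient is a functional whose kernel contains no
nonzero ideal. -/
theorem IsGorensteinFinDim.exists_functional {S M : Type*} [CommRing S] [Algebra ℂ S]
    [AddCommGroup M] [Module ℂ M] {I : Ideal S} (hGor : IsGorensteinFinDim ℂ (S ⧸ I))
    {ψ : S →ₗ[ℂ] M} (hsurj : Function.Surjective ψ) (hker : ∀ f, ψ f = 0 ↔ f ∈ I) :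
    ∃ φ : Dual ℂ M, ∀ f₀, (∀ f, φ (ψ (f * f₀)) = 0) → ψ f₀ = 0 := by
  obtain ⟨-, e, he⟩ := hGor
  obtain ⟨σ, hσ⟩ := ψ.exists_rightInverse_of_surjective (LinearMap.range_eq_top.2 hsurj)
  let q : S →ₗ[ℂ] S ⧸ I := (Ideal.Quotient.mkₐ ℂ I).toLinearMap
  have hq : ∀ f, q (σ (ψ f)) = q f := by
    intro f
    refine Ideal.Quotient.eq.2 ((hker _).1 ?_)
    rw [map_sub, sub_eq_zero]
    exact LinearMap.congr_fun hσ _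
  -- The functional e(1), transported to M by a linear section of ψ. Since e(f₀)(f) = e(1)(f₀ f),
  -- its vanishing on all multiples of f₀ gives e(f₀) = 0.
  refine ⟨e 1 ∘ₗ q ∘ₗ σ, fun f₀ hφ => ?_⟩
  refine (hker f₀).2 (Ideal.Quotient.eq_zero_iff_mem.1 (e.map_eq_zero_iff.1 ?_))
  refine LinearMap.ext fun b => ?_
  obtain ⟨f, rfl⟩ := Ideal.Quotient.mk_surjective b
  have h := he (Ideal.Quotient.mk _ f₀) 1 (Ideal.Quotient.mk _ f)
  rw [mul_one, mul_comm, ← map_mul] at h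
  have h' : e 1 (q (f * f₀)) = 0 := by
    rw [← hq]
    exact hφ f
  rw [h]
  exact h'

/-- A socle vector spans an ideal of dimension at most one, so if φ kills the vector it kills that
whole ideal, which must then be zero. -/
theorem exists_functional_on_quotient [Fintype (reflections W)]
    (J : Submodule (CherednikAlgebra R c) (PolyRep R c))
    (hGor : IsGorensteinFinDim ℂ (Poly V ⧸ toIdeal J)) :
    ∃ φ : Dual ℂ (PolyRep R c ⧸ J), ∀ m, (∀ x, hx R c x • m = 0) → φ m = 0 → m = 0 := by
  have hsurj := polyAct_surjective (isLowestWeight_mk_vac J)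
  obtain ⟨φ, hφ⟩ := hGor.exists_functional hsurj fun f => by
    rw [polyAct_apply, ← map_smul, Submodule.mkQ_apply, Submodule.Quotient.mk_eq_zero]
    rfl
  refine ⟨φ, fun m hm hφm => ?_⟩
  obtain ⟨f₀, rfl⟩ := hsurj m
  refine hφ f₀ fun f => ?_
  obtain ⟨a, ha⟩ := polyMap_smul_of_socle hm f
  rw [polyAct_apply] at ha hφm ⊢
  rw [map_mul, mul_smul, ha, map_smul, hφm, smul_zero]

end

end RationalCherednik

theorem theorem2p2 {V : Type*} [AddCommGroup V] [Module ℂ V] [FiniteDimensional ℂ V]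
    (W : Subgroup (V ≃ₗ[ℂ] V)) (hW : RationalCherednik.IsRealReflectionGroup W)
    (R : RationalCherednik.RootChoice W) (c : RationalCherednik.reflections W → ℂ)
    (hc : RationalCherednik.ConjInvariant c)
    (J : Submodule (RationalCherednik.CherednikAlgebra R c) (RationalCherednik.PolyRep R c))
    (hJ : J ≠ ⊤)
    (hfin : FiniteDimensional ℂ (RationalCherednik.PolyRep R c ⧸ J))
    (hGor : RationalCherednik.IsGorensteinFinDim ℂ
      (RationalCherednik.Poly V ⧸ RationalCherednik.toIdeal J)) :
    J = RationalCherednik.maxSubmodule R c ∧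
      IsSimpleModule (RationalCherednik.CherednikAlgebra R c)
        (RationalCherednik.PolyRep R c ⧸ J) := by
  obtain ⟨F⟩ := hW.exists_invariantForm
  have := hW.finite
  have := Fintype.ofFinite (RationalCherednik.reflections W)
  obtain ⟨φ, hφ⟩ := RationalCherednik.exists_functional_on_quotient J hGor
  have hsimple : IsSimpleModule (RationalCherednik.CherednikAlgebra R c)
      (RationalCherednik.PolyRep R c ⧸ J) := by
    have := Submodule.Quotient.nontrivial_iff.2 hJ
    refine (isSimpleModule_iff _ _).2 ⟨fun N => or_iff_not_imp_left.2 fun hN => ?_⟩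
    have hv := RationalCherednik.isLowestWeight_mk_vac J
    have hinv := RationalCherednik.invariant_restrictScalars N
    have hmem := hinv.lowestWeight_mem F hv φ hφ
      (fun h => hN ((Submodule.restrictScalars_eq_bot_iff ℂ _ _).1 h))
    exact (Submodule.restrictScalars_eq_top_iff ℂ _ _).1 (hv.generates _ hinv hmem)
  exact ⟨RationalCherednik.eq_maxSubmodule_of_isCoatom F (isSimpleModule_iff_isCoatom.1 hsimple),
    hsimple⟩
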